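/- Let $\Bbbk$ be a field. For a finite set $J$, a \emph{word} on $J$ is a total ordering of $J$, a \emph{path} on $J$ is a word on $J$ up to reversal, and a \emph{set of paths} on $J$ is a partition of $J$ together with a path on each part. Let $F[J]$ be the $\Bbbk$-vector space with basis the sets of paths on $J$ (so $F[\emptyset]=\Bbbk$). For $J=S\sqcup T$ let $\Delta_{S,T}:F[J]\to F[S]\otimes F[T]$, $\alpha\mapsto\alpha_{|S}\otimes\alpha_{/S}$, where $\alpha_{|S}$ is obtained from $\alpha$ by erasing all letters not in $S$ (and forgetting empty parts), and $\alpha_{/S}$ by replacing each letter in $S$ by a separation symbol $|$ (again forgetting empty parts). Let $\Delta_{S_1,\dots,S_n}$ be the iterated coproducts, and let $\zeta_J:F[J]\to\Bbbk$ be the linear map sending a set of paths to $1$ if all its paths have exactly one element and to $0$ otherwise. For a finite set $I$, $x\in F[I]$ and $n\in\mathbb N$ put $$\chi^F_I(x)(n)=\sum_{(S_1,\dots,S_n)}\bigl(\zeta_{S_1}\otimes\dots\otimes\zeta_{S_n}\bigr)\bigl(\Delta_{S_1,\dots,S_n}(x)\bigr),$$ the sum being over all sequences of $n$ pairwise disjoint,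 possibly empty, subsets with union $I$ (the basic invariant of the Hopf monoid $F$ of sets of paths). Let $I$ be a finite set and let $\alpha$ be a path on $I$; fix one of the (at most two) total orderings $w$ of $I$ that represent $\alpha$. Given a binary tree $t$ with $|I|$ vertices (left and right children are distinguished), identify its vertices, read from left to right (in-order), with the elements of $I$ in the order $w$. A coloring $c:I\to[n]=\{1,\dots,n\}$ is \emph{compatible} with $t$ if $c(u)\le c(v)$ whenever $u$ is a child of $v$ in $t$, and \emph{strictly compatible} with $t$ if $c(u)<c(v)$ whenever $u$ is a child of $v$ in $t$. Then: 1. For every $n\in\mathbb N$, $\chi^F_I(\alpha)(n)$ is (the image in $\Bbbk$ of) the number of strictly compatible pairs consisting of a binary tree with $|I|$ vertices and a coloring $I\to[n]$. 2. If $\Bbbk$ has characteristic $0$, there is a unique polynomial over $\Bbbk$, again denoted $\chi^F_I(\alpha)$, that takes the value $\chi^F_I(\alpha)(n)$ at every $n\in\mathbb N$; and for every $n\in\mathbb N$, $(-1)^{|I|}\chi^F_I(\alpha)(-n)$ is the number of compatible pairs consisting of a binary tree with $|I|$ vertices and a coloring $I\to[n]$. In particular $$(-1)^{|I|}\chi^F_I(\alpha)(-1)=C_{|I|},$$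 where $C_m=\frac1{m+1}\binom{2m}{m}$ is the $m$-th Catalan number. -/

import Mathlib

open scoped TensorProduct

noncomputable section

namespace PathMonoid

/-! ### Words up to reversal -/

/-- Two words are identified when they are equal or reverse to one another. -/
def revSetoid (V : Type*) : Setoid (List V) where
  r w w' := w' = w ∨ w' = w.reverse
  iseqv := by
    refine ⟨fun w => Or.inl rfl, ?_, ?_⟩
    · rintro x y (rfl | rfl) <;> simp
    · rintro x y z (rfl | rfl) (rfl | rfl) <;> simp

/-- Words with letters in `V`, up to reversal. -/
def UWord (V : Type*) : Type _ := Quotient (revSetoid V)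

namespace UWord

/-- The class of a word. -/
def mk {V : Type*} (w : List V) : UWord V := Quotient.mk (revSetoid V) w

theorem mk_eq_mk {V : Type*} {w w' : List V} :
    mk w = mk w' ↔ w' = w ∨ w' = w.reverse :=
  Quotient.eq (r := revSetoid V)

theorem exists_rep {V : Type*} (p : UWord V) : ∃ w, mk w = p :=
  Quotient.exists_rep p

/-- No letter is repeated. -/
def Nodup {V : Type*} (p : UWord V) : Prop :=
  Quotient.liftOn p List.Nodup (by
    rintro a b (rfl | rfl) <;> simp)

@[simp] theorem nodup_mk {V : Type*} (w : List V) : (mk w).Nodup ↔ w.Nodup := Iff.rfl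

/-- The set of letters. -/
def support {V : Type*} [DecidableEq V] (p : UWord V) : Finset V :=
  Quotient.liftOn p List.toFinset (by
    rintro a b (rfl | rfl) <;> simp)

@[simp] theorem support_mk {V : Type*} [DecidableEq V] (w : List V) :
    (mk w).support = w.toFinset := rfl

/-- `p ∩ S`: erase the letters that are not in `S`. -/
def restrict {V : Type*} [DecidableEq V] (S : Finset V) (p : UWord V) : UWord V :=
  Quotient.liftOn p (fun w => mk (w.filter (fun v => decide (v ∈ S)))) (by
    rintro a b (rfl | rfl)
    · rfl
    · exact mk_eq_mk.2 (Or.inr (by simp)))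

@[simp] theorem restrict_mk {V : Type*} [DecidableEq V] (S : Finset V) (w : List V) :
    (mk w).restrict S = mk (w.filter (fun v => decide (v ∈ S))) := rfl

theorem support_restrict {V : Type*} [DecidableEq V] (S : Finset V) (p : UWord V) :
    (p.restrict S).support = p.support ∩ S := by
  obtain ⟨w, rfl⟩ := p.exists_rep
  ext v
  simp

/-- `q` is one of the (possibly empty) words into which `p` falls apart when every letter that
lies in `S` is replaced by a separation symbol. -/
def IsPiece {V : Type*} [DecidableEq V] (S : Finset V) (p q : UWord V) : Prop :=
  ∃ w s : List V, mk w = p ∧ s ∈ w.splitOnP (fun v => decide (v ∈ S)) ∧ mk s = q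

end UWord

theorem splitOnP_reverse {V : Type*} (f : V → Bool) (w : List V) :
    w.reverse.splitOnP f = ((w.splitOnP f).map List.reverse).reverse := by
  induction h : w.length using Nat.strong_induction_on generalizing w with
  | _ n ih =>
    by_cases hw : ∀ x ∈ w, f x = false
    · rw [List.splitOnP_eq_singleton hw, List.splitOnP_eq_singleton (by simpa using hw)]
      simp
    · push Not at hw
      obtain ⟨a, ha, hfa⟩ := hw
      obtain ⟨x, y, rfl⟩ := List.append_of_mem ha
      have hfa' : f a = true := by simpa using hfa
      have e : (x ++ a :: y).reverse = y.reverse ++ a :: x.reverse := by simp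
      simp only [List.length_append, List.length_cons] at h
      rw [e, List.splitOnP_append_cons _ _ hfa', List.splitOnP_append_cons _ _ hfa',
        ih x.length (by omega) x rfl, ih y.length (by omega) y rfl]
      simp

theorem flatten_splitOnP {V : Type*} (f : V → Bool) (w : List V) :
    (w.splitOnP f).flatten = w.filter (fun v => !f v) := by
  induction h : w.length using Nat.strong_induction_on generalizing w with
  | _ n ih =>
    by_cases hw : ∀ x ∈ w, f x = false
    · rw [List.splitOnP_eq_singleton hw]
      simp only [List.flatten_cons, List.flatten_nil, List.append_nil]
      exact (List.filter_eq_self.2 (by simpa using hw)).symm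
    · push Not at hw
      obtain ⟨a, ha, hfa⟩ := hw
      obtain ⟨x, y, rfl⟩ := List.append_of_mem ha
      have hfa' : f a = true := by simpa using hfa
      simp only [List.length_append, List.length_cons] at h
      rw [List.splitOnP_append_cons _ _ hfa', List.flatten_append,
        ih x.length (by omega) x rfl, ih y.length (by omega) y rfl]
      simp [hfa']

namespace UWord

theorem isPiece_mk {V : Type*} [DecidableEq V] (S : Finset V) (w : List V) (q : UWord V) :
    IsPiece S (mk w) q ↔ ∃ s ∈ w.splitOnP (fun v => decide (v ∈ S)), mk s = q := by
  constructor
  · rintro ⟨w', s, hw, hs, rfl⟩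
    rcases mk_eq_mk.1 hw with rfl | rfl
    · exact ⟨s, hs, rfl⟩
    · refine ⟨s.reverse, ?_, mk_eq_mk.2 (Or.inr (by simp))⟩
      rw [splitOnP_reverse]
      simpa using hs
  · rintro ⟨s, hs, rfl⟩
    exact ⟨w, s, rfl, hs, rfl⟩

theorem exists_isPiece {V : Type*} [DecidableEq V] {S : Finset V} {p : UWord V} {v : V} :
    (∃ q, IsPiece S p q ∧ v ∈ q.support) ↔ v ∈ p.support ∧ v ∉ S := by
  obtain ⟨w, rfl⟩ := p.exists_rep
  have h := congrArg (v ∈ ·) (flatten_splitOnP (fun v => decide (v ∈ S)) w)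
  simp only [List.mem_flatten, List.mem_filter, eq_iff_iff] at h
  simp only [isPiece_mk, support_mk, List.mem_toFinset]
  constructor
  · rintro ⟨_, ⟨s, hs, rfl⟩, hv⟩
    simpa using h.1 ⟨s, hs, by simpa using hv⟩
  · intro hv
    obtain ⟨s, hs, hvs⟩ := h.2 (by simpa using hv)
    exact ⟨mk s, ⟨s, hs, rfl⟩, by simpa using hvs⟩

theorem IsPiece.nodup {V : Type*} [DecidableEq V] {S : Finset V} {p q : UWord V}
    (h : IsPiece S p q) (hp : p.Nodup) : q.Nodup := by
  obtain ⟨w, rfl⟩ := p.exists_rep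
  obtain ⟨s, hs, rfl⟩ := (isPiece_mk S w q).1 h
  have hn : ((w.splitOnP (fun v => decide (v ∈ S))).flatten).Nodup := by
    rw [flatten_splitOnP]
    exact List.Nodup.filter _ hp
  exact (List.nodup_flatten.1 hn).1 s hs

theorem IsPiece.eq_of_mem {V : Type*} [DecidableEq V] {S : Finset V} {p q q' : UWord V} {v : V}
    (hp : p.Nodup) (h : IsPiece S p q) (h' : IsPiece S p q')
    (hv : v ∈ q.support) (hv' : v ∈ q'.support) : q = q' := by
  obtain ⟨w, rfl⟩ := p.exists_rep
  obtain ⟨s, hs, rfl⟩ := (isPiece_mk S w q).1 h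
  obtain ⟨s', hs', rfl⟩ := (isPiece_mk S w q').1 h'
  have hn : ((w.splitOnP (fun v => decide (v ∈ S))).flatten).Nodup := by
    rw [flatten_splitOnP]
    exact List.Nodup.filter _ hp
  by_contra hne
  have hss : s ≠ s' := fun e => hne (by rw [e])
  have : Std.Symm (List.Disjoint (α := V)) := ⟨fun _ _ h => h.symm⟩
  exact (List.nodup_flatten.1 hn).2.forall hs hs' hss (by simpa using hv) (by simpa using hv')

end UWord

/-! ### The species of sets of paths -/

/-- A set of paths on the finite set `I`: a partition of `I` together with, on each part, a word
using every element of the part exactly once, taken up to reversal. It is recorded as the set of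
these paths. -/
@[ext]
structure SetOfPaths {V : Type*} [DecidableEq V] (I : Finset V) where
  /-- The paths. -/
  paths : Set (UWord V)
  nodup : ∀ p ∈ paths, p.Nodup
  nonempty : ∀ p ∈ paths, p.support.Nonempty
  disjoint : ∀ p ∈ paths, ∀ q ∈ paths, p ≠ q → Disjoint p.support q.support
  cover : ∀ v, v ∈ I ↔ ∃ p ∈ paths, v ∈ p.support

namespace SetOfPaths

/-- The restriction `α_{|S} = s₁ ∩ S | ⋯ | s_l ∩ S`, forgetting the empty parts. -/
def restrict {V : Type*} [DecidableEq V] {I : Finset V} (α : SetOfPaths I) (S : Finset V)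
    (hS : S ⊆ I) : SetOfPaths S where
  paths := {q | q.support.Nonempty ∧ ∃ p ∈ α.paths, q = p.restrict S}
  nodup := by
    rintro q ⟨-, p, hp, rfl⟩
    obtain ⟨w, rfl⟩ := p.exists_rep
    exact List.Nodup.filter _ (α.nodup _ hp)
  nonempty := fun q hq => hq.1
  disjoint := by
    rintro q ⟨-, p, hp, rfl⟩ q' ⟨-, p', hp', rfl⟩ hne
    rw [UWord.support_restrict, UWord.support_restrict]
    exact (α.disjoint p hp p' hp' (fun e => hne (by rw [e]))).mono
      Finset.inter_subset_left Finset.inter_subset_left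
  cover := by
    intro v
    constructor
    · intro hv
      obtain ⟨p, hp, hvp⟩ := (α.cover v).1 (hS hv)
      have hm : v ∈ (p.restrict S).support := by
        rw [UWord.support_restrict]; exact Finset.mem_inter.2 ⟨hvp, hv⟩
      exact ⟨_, ⟨⟨v, hm⟩, p, hp, rfl⟩, hm⟩
    · rintro ⟨q, ⟨-, p, hp, rfl⟩, hv⟩
      rw [UWord.support_restrict] at hv
      exact (Finset.mem_inter.1 hv).2

/-- The contraction `α_{/S}`: each occurrence of an element of `S` in `α` is replaced by the
separation symbol. Its ground set is the complement `T` of `S`. -/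
def contract {V : Type*} [DecidableEq V] {I : Finset V} (α : SetOfPaths I) (S T : Finset V)
    (hST : S ∪ T = I) (hd : Disjoint S T) : SetOfPaths T where
  paths := {q | q.support.Nonempty ∧ ∃ p ∈ α.paths, UWord.IsPiece S p q}
  nodup := by
    rintro q ⟨-, p, hp, h⟩
    exact h.nodup (α.nodup p hp)
  nonempty := fun q hq => hq.1
  disjoint := by
    rintro q ⟨-, p, hp, h⟩ q' ⟨-, p', hp', h'⟩ hne
    rw [Finset.disjoint_left]
    intro v hv hv'
    have h1 := (UWord.exists_isPiece.1 ⟨q, h, hv⟩).1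
    have h2 := (UWord.exists_isPiece.1 ⟨q', h', hv'⟩).1
    have e : p = p' := by
      by_contra hpp
      exact Finset.disjoint_left.1 (α.disjoint p hp p' hp' hpp) h1 h2
    subst e
    exact hne (UWord.IsPiece.eq_of_mem (α.nodup p hp) h h' hv hv')
  cover := by
    intro v
    constructor
    · intro hv
      obtain ⟨p, hp, hvp⟩ := (α.cover v).1 (hST ▸ Finset.mem_union_right S hv)
      obtain ⟨q, hq, hvq⟩ := UWord.exists_isPiece.2
        ⟨hvp, fun hvS => Finset.disjoint_left.1 hd hvS hv⟩
      exact ⟨q, ⟨⟨v, hvq⟩, p, hp, hq⟩, hvq⟩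
    · rintro ⟨q, ⟨-, p, hp, h⟩, hv⟩
      obtain ⟨h1, h2⟩ := UWord.exists_isPiece.1 ⟨q, h, hv⟩
      have h3 : v ∈ S ∪ T := hST ▸ (α.cover v).2 ⟨p, hp, h1⟩
      exact (Finset.mem_union.1 h3).resolve_left h2

/-- A set of paths is discrete when all its paths have only one element. -/
def IsDiscrete {V : Type*} [DecidableEq V] {I : Finset V} (α : SetOfPaths I) : Prop :=
  ∀ p ∈ α.paths, ∃ v, p = UWord.mk [v]

/-- The set of paths on `I` given by a single path: the class of a word `w` in which every element
of `I` appears exactly once. (On `I = ∅` it is the empty set of paths.) -/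
def ofWord {V : Type*} [DecidableEq V] {I : Finset V} (w : List V) (hw : w.Nodup)
    (hI : w.toFinset = I) : SetOfPaths I where
  paths := {q | q.support.Nonempty ∧ q = UWord.mk w}
  nodup := by
    rintro q ⟨-, rfl⟩
    exact hw
  nonempty := fun q hq => hq.1
  disjoint := by
    rintro q ⟨-, rfl⟩ q' ⟨-, rfl⟩ hne
    exact absurd rfl hne
  cover := by
    intro v
    subst hI
    constructor
    · intro hv
      exact ⟨UWord.mk w, ⟨⟨v, hv⟩, rfl⟩, hv⟩
    · rintro ⟨q, ⟨-, rfl⟩, hv⟩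
      exact hv

/-- `α` consists of a single path on `I`, and `w` is one of the two total orderings of `I` that
represent this path. -/
def IsPathWithWord {V : Type*} [DecidableEq V] {I : Finset V} (α : SetOfPaths I) (w : List V) :
    Prop :=
  ∃ (hw : w.Nodup) (hI : w.toFinset = I), α = ofWord w hw hI

end SetOfPaths

/-- The vector space `F[I]`, free on the sets of paths on `I`. -/
abbrev F (𝕜 : Type*) [Field 𝕜] {V : Type*} [DecidableEq V] (I : Finset V) : Type _ :=
  SetOfPaths I →₀ 𝕜

/-- The coproduct `Δ_{S,T} : F[I] → F[S] ⊗ F[T]`, `α ↦ α_{|S} ⊗ α_{/S}`, for `I = S ⊔ T`. -/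
def coproduct (𝕜 : Type*) [Field 𝕜] {V : Type*} [DecidableEq V] {I : Finset V} (S T : Finset V)
    (hST : S ∪ T = I) (hd : Disjoint S T) : F 𝕜 I →ₗ[𝕜] F 𝕜 S ⊗[𝕜] F 𝕜 T :=
  Finsupp.linearCombination 𝕜 fun α : SetOfPaths I =>
    (Finsupp.single (α.restrict S (hST ▸ Finset.subset_union_left)) 1 : F 𝕜 S) ⊗ₜ[𝕜]
      (Finsupp.single (α.contract S T hST hd) 1 : F 𝕜 T)

open Classical in
/-- The character `ζ_I : F[I] → 𝕜` that sends discrete sets of paths to `1` and the other sets of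
paths to `0`. -/
def zeta (𝕜 : Type*) [Field 𝕜] {V : Type*} [DecidableEq V] (I : Finset V) : F 𝕜 I →ₗ[𝕜] 𝕜 :=
  Finsupp.linearCombination 𝕜 fun α : SetOfPaths I => if α.IsDiscrete then 1 else 0

/-- The canonical isomorphism `F[∅] ≅ 𝕜`, sending the empty set of paths to `1`. -/
def counit (𝕜 : Type*) [Field 𝕜] {V : Type*} [DecidableEq V] (I : Finset V) : F 𝕜 I →ₗ[𝕜] 𝕜 :=
  Finsupp.linearCombination 𝕜 fun _ : SetOfPaths I => 1

/-! ### Decompositions, iterated coproducts and the basic invariant -/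

/-- `(S₁, …, S_n) ⊢ I`: the sets are pairwise disjoint, possibly empty, with union `I`. -/
def IsDecomposition {V : Type*} [DecidableEq V] {n : ℕ} (S : Fin n → Finset V) (I : Finset V) :
    Prop :=
  (∀ i j, i ≠ j → Disjoint (S i) (S j)) ∧ Finset.univ.biUnion S = I

theorem IsDecomposition.union_tail {V : Type*} [DecidableEq V] {n : ℕ} {S : Fin (n + 1) → Finset V}
    {I : Finset V} (h : IsDecomposition S I) :
    S 0 ∪ Finset.univ.biUnion (fun i : Fin n => S i.succ) = I := by
  rw [← h.2]
  ext v
  simp [Fin.exists_fin_succ]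

theorem IsDecomposition.disjoint_tail {V : Type*} [DecidableEq V] {n : ℕ}
    {S : Fin (n + 1) → Finset V} {I : Finset V} (h : IsDecomposition S I) :
    Disjoint (S 0) (Finset.univ.biUnion (fun i : Fin n => S i.succ)) := by
  rw [Finset.disjoint_biUnion_right]
  exact fun i _ => h.1 _ _ (Fin.succ_ne_zero i).symm

theorem IsDecomposition.tail {V : Type*} [DecidableEq V] {n : ℕ} {S : Fin (n + 1) → Finset V}
    {I : Finset V} (h : IsDecomposition S I) :
    IsDecomposition (fun i : Fin n => S i.succ)
      (Finset.univ.biUnion (fun i : Fin n => S i.succ)) :=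
  ⟨fun _ _ hij => h.1 _ _ (fun e => hij (Fin.succ_injective n e)), rfl⟩

/-- The decompositions of `I` of length `n`. -/
def decompositions {V : Type*} [DecidableEq V] (I : Finset V) (n : ℕ) :
    Finset (Fin n → Finset V) :=
  open Classical in
  (Fintype.piFinset fun _ : Fin n => I.powerset).filter fun S => IsDecomposition S I

theorem mem_decompositions {V : Type*} [DecidableEq V] {I : Finset V} {n : ℕ}
    {S : Fin n → Finset V} : S ∈ decompositions I n ↔ IsDecomposition S I := by
  simp only [decompositions, Finset.mem_filter, Fintype.mem_piFinset, Finset.mem_powerset,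
    and_iff_right_iff_imp]
  intro h i
  rw [← h.2]
  exact Finset.subset_biUnion_of_mem S (Finset.mem_univ i)

/-- The canonical map `M₀ ⊗ (M₁ ⊗ ⋯ ⊗ M_n) → M₀ ⊗ M₁ ⊗ ⋯ ⊗ M_n`. -/
def consTensor (𝕜 : Type*) [Field 𝕜] {n : ℕ} (M : Fin (n + 1) → Type*)
    [∀ i, AddCommGroup (M i)] [∀ i, Module 𝕜 (M i)] :
    M 0 ⊗[𝕜] (⨂[𝕜] i : Fin n, M i.succ) →ₗ[𝕜] ⨂[𝕜] i, M i :=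
  TensorProduct.lift
    ((PiTensorProduct.lift (R := 𝕜) (s := fun i : Fin n => M i.succ)
        (E := ⨂[𝕜] i, M i)).toLinearMap ∘ₗ (PiTensorProduct.tprod 𝕜 (s := M)).curryLeft)

/-- The iterated coproduct `Δ_{S₁, …, S_n} : F[I] → F[S₁] ⊗ ⋯ ⊗ F[S_n]`, defined by
`Δ_{S₁, …, S_n} = (id ⊗ Δ_{S₂, …, S_n}) ∘ Δ_{S₁, S₂ ⊔ ⋯ ⊔ S_n}`. -/
def iteratedCoproduct (𝕜 : Type*) [Field 𝕜] {V : Type*} [DecidableEq V] :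
    ∀ {n : ℕ} (S : Fin n → Finset V) {I : Finset V}, IsDecomposition S I →
      (F 𝕜 I →ₗ[𝕜] ⨂[𝕜] i, F 𝕜 (S i))
  | 0, _, I, _ => (PiTensorProduct.isEmptyEquiv (Fin 0)).symm.toLinearMap ∘ₗ counit 𝕜 I
  | _ + 1, S, _, h =>
    consTensor 𝕜 (fun i => F 𝕜 (S i)) ∘ₗ
      TensorProduct.map LinearMap.id (iteratedCoproduct 𝕜 (fun i => S i.succ) h.tail) ∘ₗ
        coproduct 𝕜 (S 0) _ h.union_tail h.disjoint_tail

/-- `ζ_{S₁} ⊗ ⋯ ⊗ ζ_{S_n} : F[S₁] ⊗ ⋯ ⊗ F[S_n] → 𝕜`. -/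
def zetaTensor (𝕜 : Type*) [Field 𝕜] {V : Type*} [DecidableEq V] {n : ℕ} (S : Fin n → Finset V) :
    (⨂[𝕜] i, F 𝕜 (S i)) →ₗ[𝕜] 𝕜 :=
  PiTensorProduct.lift
    ((MultilinearMap.mkPiAlgebra 𝕜 (Fin n) 𝕜).compLinearMap fun i => zeta 𝕜 (S i))

/-- The basic invariant
`χ_I(x)(n) = ∑_{(S₁, …, S_n) ⊢ I} (ζ_{S₁} ⊗ ⋯ ⊗ ζ_{S_n}) (Δ_{S₁, …, S_n}(x))`, for `n ∈ ℕ`. -/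
def chi (𝕜 : Type*) [Field 𝕜] {V : Type*} [DecidableEq V] {I : Finset V} (x : F 𝕜 I) (n : ℕ) : 𝕜 :=
  ∑ S : {S : Fin n → Finset V // S ∈ decompositions I n},
    zetaTensor 𝕜 S.1 (iteratedCoproduct 𝕜 S.1 (mem_decompositions.1 S.2) x)

/-- The polynomial `P` takes the values of the basic invariant of `x` at all `n ∈ ℕ`. -/
def IsBasicInvariantPolynomial {𝕜 : Type*} [Field 𝕜] {V : Type*} [DecidableEq V] {I : Finset V}
    (x : F 𝕜 I) (P : Polynomial 𝕜) : Prop :=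
  ∀ n : ℕ, P.eval (n : 𝕜) = chi 𝕜 x n

/-! ### Binary trees and colorings -/

/-- The sequence of labels of a binary tree, read from left to right (left subtree, root, right
subtree). -/
def inorder {V : Type*} : BinaryTree V → List V
  | .nil => []
  | .node a l r => inorder l ++ a :: inorder r

/-- The label of the root, if there is one. -/
def root? {V : Type*} : BinaryTree V → Option V
  | .nil => none
  | .node a _ _ => some a

/-- `IsChild t u v`: some vertex of `t` labelled `u` is a child of a vertex labelled `v`. -/
def IsChild {V : Type*} : BinaryTree V → V → V → Prop
  | .nil, _, _ => False
  | .node a l r, u, v =>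
    (v = a ∧ (root? l = some u ∨ root? r = some u)) ∨ IsChild l u v ∨ IsChild r u v

/-- `t'` is the binary tree `t` with its vertices identified with the letters of `w` from left to
right, so that a vertex is carried to the letter with the same number of letters on its left. -/
def IsLabelling {V : Type*} (w : List V) (t : BinaryTree Unit) (t' : BinaryTree V) : Prop :=
  t'.map (fun _ => ()) = t ∧ inorder t' = w

/-- The coloring `c : I → [n]` is compatible with the tree `t`, whose vertices are identified with
the elements of `I` along `w`: on every edge, oriented to the parent, the parent has maximal
color. -/
def Compatible {V : Type*} {I : Finset V} {n : ℕ} (w : List V) (t : BinaryTree Unit)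
    (c : I → Fin n) : Prop :=
  ∃ t', IsLabelling w t t' ∧ ∀ u v : I, IsChild t' (u : V) (v : V) → c u ≤ c v

/-- Strict compatibility: on every edge the parent is the unique vertex of maximal color. -/
def StrictlyCompatible {V : Type*} {I : Finset V} {n : ℕ} (w : List V) (t : BinaryTree Unit)
    (c : I → Fin n) : Prop :=
  ∃ t', IsLabelling w t t' ∧ ∀ u v : I, IsChild t' (u : V) (v : V) → c u < c v

/-- The number of compatible pairs (binary tree with `|I|` vertices, coloring with `[n]`). -/
def numCompatible {V : Type*} (I : Finset V) (w : List V) (n : ℕ) : ℕ :=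
  Nat.card {p : BinaryTree Unit × (I → Fin n) // p.1.numNodes = I.card ∧ Compatible w p.1 p.2}

/-- The number of strictly compatible pairs (binary tree with `|I|` vertices, coloring with
`[n]`). -/
def numStrictlyCompatible {V : Type*} (I : Finset V) (w : List V) (n : ℕ) : ℕ :=
  Nat.card
    {p : BinaryTree Unit × (I → Fin n) // p.1.numNodes = I.card ∧ StrictlyCompatible w p.1 p.2}

end PathMonoid

end

/-! A sequence (S_1, …, S_n) contributes 1 or 0 to the invariant of a path: 1 exactly when S_1 meets
the word in at most one letter, S_2 meets each piece left after cutting at S_1 in at most one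
letter, and so on. With the cutting letters as roots and the pieces as subtrees, this says that the
word is the in-order reading of a tree on which the block index strictly increases away from the
root (`hasIncreasingTree_iff_pieces`, `zetaTensor_iteratedCoproduct_single`). Giving S_i the color n
+ 1 - i turns sequences into colorings. The tree belonging to a coloring is unique
(`ChildRel.eq_of_inorder_eq`), so counting colorings is counting strictly compatible pairs.

For the reciprocity the word is irrelevant: pairs are the same as trees labelled by colors
(`card_pairs_eq_card_coloredTrees`). Let a_m(n) and b_m(n) be the cardinalities of `coloredTrees e m
n` for e = 1 (strict) and e = 0 (weak). Asking whether the root has the top color gives a_{m+1}(n+1)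
= a_{m+1}(n) + ∑_{i+j=m} a_i(n) a_j(n), b_{m+1}(n+1) = b_{m+1}(n) + ∑_{i+j=m} b_i(n+1) b_j(n+1). In
characteristic 0 the first recursion makes every a_m a polynomial. Evaluated at -(n+1) and
multiplied by (-1)^{m+1}, it becomes the second recursion for (-1)^m a_m(-n); the initial values
agree, hence (-1)^m a_m(-n) = b_m(n). For n = 1 the second recursion is the Catalan one. -/

namespace PathMonoid

/-! ### Labelled binary trees -/

/-- Every vertex of `t` is related to its parent. -/
def ChildRel {V : Type*} (R : V → V → Prop) (t : BinaryTree V) : Prop :=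
  ∀ u v, IsChild t u v → R u v

theorem childRel_nil {V : Type*} (R : V → V → Prop) : ChildRel R .nil := fun _ _ h => h.elim

theorem childRel_node {V : Type*} {R : V → V → Prop} {a : V} {l r : BinaryTree V} :
    ChildRel R (.node a l r) ↔ (∀ u, root? l = some u → R u a) ∧
      (∀ u, root? r = some u → R u a) ∧ ChildRel R l ∧ ChildRel R r := by
  constructor
  · intro h
    exact ⟨fun u hu => h u a (Or.inl ⟨rfl, Or.inl hu⟩), fun u hu => h u a (Or.inl ⟨rfl, Or.inr hu⟩),
      fun u v huv => h u v (Or.inr (Or.inl huv)), fun u v huv => h u v (Or.inr (Or.inr huv))⟩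
  · rintro ⟨h1, h2, h3, h4⟩ u v (⟨rfl, h | h⟩ | h | h)
    exacts [h1 u h, h2 u h, h3 u v h, h4 u v h]

theorem mem_inorder_of_root? {V : Type*} {t : BinaryTree V} {u : V} (h : root? t = some u) :
    u ∈ inorder t := by
  cases t with
  | nil => simp [root?] at h
  | node a l r => simp [root?] at h; simp [inorder, h]

theorem ChildRel.root_of_mem {V : Type*} {R : V → V → Prop} (hR : ∀ x y z, R x y → R y z → R x z)
    {t : BinaryTree V} (h : ChildRel R t) {a : V} (ha : ∀ u, root? t = some u → R u a) :
    ∀ u ∈ inorder t, R u a := by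
  induction t generalizing a with
  | nil => simp [inorder]
  | node b l r hl hr =>
    obtain ⟨h1, h2, h3, h4⟩ := childRel_node.1 h
    have hb : R b a := ha b rfl
    intro u hu
    simp only [inorder, List.mem_append, List.mem_cons] at hu
    rcases hu with hu | rfl | hu
    exacts [hR _ _ _ (hl h3 h1 u hu) hb, hb, hR _ _ _ (hr h4 h2 u hu) hb]

/-- Transitivity carries the edge condition along the path from any vertex up to the root. The
condition then depends on the subtrees only through their words, the form that all later inductions
on trees use. -/
theorem childRel_node_iff_of_trans {V : Type*} {R : V → V → Prop}
    (hR : ∀ x y z, R x y → R y z → R x z) {a : V} {l r : BinaryTree V} :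
    ChildRel R (.node a l r) ↔ (∀ u ∈ inorder l, R u a) ∧ (∀ u ∈ inorder r, R u a) ∧
      ChildRel R l ∧ ChildRel R r := by
  rw [childRel_node]
  constructor
  · rintro ⟨h1, h2, h3, h4⟩
    exact ⟨h3.root_of_mem hR h1, h4.root_of_mem hR h2, h3, h4⟩
  · rintro ⟨h1, h2, h3, h4⟩
    exact ⟨fun u hu => h1 u (mem_inorder_of_root? hu), fun u hu => h2 u (mem_inorder_of_root? hu),
      h3, h4⟩

theorem isChild_mem {V : Type*} {t : BinaryTree V} {u v : V} (h : IsChild t u v) :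
    u ∈ inorder t ∧ v ∈ inorder t := by
  induction t with
  | nil => exact h.elim
  | node a l r hl hr =>
    simp only [inorder, List.mem_append, List.mem_cons]
    rcases h with ⟨rfl, h | h⟩ | h | h
    · exact ⟨Or.inl (mem_inorder_of_root? h), by simp⟩
    · exact ⟨Or.inr (Or.inr (mem_inorder_of_root? h)), by simp⟩
    · exact ⟨Or.inl (hl h).1, Or.inl (hl h).2⟩
    · exact ⟨Or.inr (Or.inr (hr h).1), Or.inr (Or.inr (hr h).2)⟩

theorem childRel_map {V W : Type*} (f : V → W) {R : W → W → Prop} {t : BinaryTree V} :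
    ChildRel R (t.map f) ↔ ChildRel (fun u v => R (f u) (f v)) t := by
  have hroot : ∀ s : BinaryTree V, root? (s.map f) = (root? s).map f := by
    intro s; cases s <;> rfl
  induction t with
  | nil => exact ⟨fun _ => childRel_nil _, fun _ => childRel_nil _⟩
  | node a l r hl hr =>
    simp only [BinaryTree.map, childRel_node, hl, hr, hroot]
    simp

theorem inorder_map {V W : Type*} (f : V → W) (t : BinaryTree V) :
    inorder (t.map f) = (inorder t).map f := by
  induction t with
  | nil => rfl
  | node a l r hl hr => simp [BinaryTree.map, inorder, hl, hr]

theorem length_inorder {V : Type*} (t : BinaryTree V) : (inorder t).length = t.numNodes := by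
  induction t with
  | nil => rfl
  | node a l r hl hr => simp [inorder, hl, hr, add_assoc]

theorem numNodes_map {V W : Type*} (f : V → W) (t : BinaryTree V) :
    (t.map f).numNodes = t.numNodes := by
  rw [← length_inorder, inorder_map, List.length_map, length_inorder]

theorem exists_isLabelling {V : Type*} {w : List V} {t : BinaryTree Unit}
    (h : t.numNodes = w.length) : ∃ t', IsLabelling w t t' := by
  induction t generalizing w with
  | nil => exact ⟨.nil, rfl, (List.length_eq_zero_iff.1 h.symm).symm⟩
  | node a l r hl hr =>
    simp only [BinaryTree.numNodes] at h
    obtain ⟨l', h1, h2⟩ := hl (w := w.take l.numNodes) (by simp; omega)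
    obtain ⟨r', h3, h4⟩ := hr (w := w.drop (l.numNodes + 1)) (by simp; omega)
    refine ⟨.node (w[l.numNodes]'(by omega)) l' r', by simp [BinaryTree.map, h1, h3], ?_⟩
    rw [inorder, h2, h4, List.cons_getElem_drop_succ, List.take_append_drop]

/-- The shape fixes the size of the left subtree, hence the place where the word is cut at the root.
-/
theorem IsLabelling.unique {V : Type*} {w : List V} {t : BinaryTree Unit} {t' t'' : BinaryTree V}
    (h' : IsLabelling w t t') (h'' : IsLabelling w t t'') : t' = t'' := by
  induction t generalizing w t' t'' with
  | nil => cases t' <;> cases t'' <;> simp_all [IsLabelling, BinaryTree.map]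
  | node a l r hl hr =>
    obtain ⟨h1, h2⟩ := h'
    obtain ⟨h3, h4⟩ := h''
    cases t' with
    | nil => simp [BinaryTree.map] at h1
    | node b' l' r' =>
      cases t'' with
      | nil => simp [BinaryTree.map] at h3
      | node b'' l'' r'' =>
        simp only [BinaryTree.map, BinaryTree.node.injEq, true_and] at h1 h3
        have hlen : (inorder l').length = (inorder l'').length := by
          rw [length_inorder, length_inorder, ← numNodes_map (fun _ => ()) l',
            ← numNodes_map (fun _ => ()) l'', h1.1, h3.1]
        obtain ⟨e1, e2⟩ := List.append_inj (h2.trans h4.symm) hlen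
        obtain ⟨rfl, e3⟩ := List.cons.inj e2
        rw [hl ⟨h1.1, e1⟩ ⟨h3.1, rfl⟩, hr ⟨h1.2, e3⟩ ⟨h3.2, rfl⟩]

/-- The root is the strict maximum of the word, so the word determines it; being strict, it occurs
only once, so it also determines the left and right subwords. Labels below it may repeat. -/
theorem ChildRel.eq_of_inorder_eq {V : Type*} {R : V → V → Prop}
    (hR : ∀ x y z, R x y → R y z → R x z) (hirr : ∀ x, ¬ R x x) {t t' : BinaryTree V}
    (h : ChildRel R t) (h' : ChildRel R t') (e : inorder t = inorder t') : t = t' := by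
  induction t generalizing t' with
  | nil =>
    cases t' with
    | nil => rfl
    | node => simp [inorder] at e
  | node a l r hl hr =>
    cases t' with
    | nil => simp [inorder] at e
    | node a' l' r' =>
      obtain ⟨h1, h2, h3, h4⟩ := (childRel_node_iff_of_trans hR).1 h
      obtain ⟨h1', h2', h3', h4'⟩ := (childRel_node_iff_of_trans hR).1 h'
      simp only [inorder] at e
      have ha : a = a' ∨ R a a' := by
        have : a ∈ inorder l' ++ a' :: inorder r' := by rw [← e]; simp
        simp only [List.mem_append, List.mem_cons] at this
        rcases this with h | h | h
        exacts [Or.inr (h1' _ h), Or.inl h, Or.inr (h2' _ h)]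
      have ha' : a' = a ∨ R a' a := by
        have : a' ∈ inorder l ++ a :: inorder r := by rw [e]; simp
        simp only [List.mem_append, List.mem_cons] at this
        rcases this with h | h | h
        exacts [Or.inr (h1 _ h), Or.inl h, Or.inr (h2 _ h)]
      have haa : a = a' := by
        rcases ha with h | h
        · exact h
        · rcases ha' with h' | h'
          exacts [h'.symm, (hirr _ (hR _ _ _ h h')).elim]
      subst haa
      obtain ⟨e1, -, e2⟩ := (List.append_cons_inj_of_notMem (fun hm => hirr _ (h1 _ hm))
        (fun hm => hirr _ (h2 _ hm))).1 e
      rw [hl h3 h3' e1, hr h4 h4' e2]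

/-! ### Counting colored binary trees -/

theorem finite_setOf_numNodes_eq_of_forall_lt (m n : ℕ) :
    {t : BinaryTree ℕ | t.numNodes = m ∧ ∀ a ∈ inorder t, a < n}.Finite := by
  induction m using Nat.strong_induction_on with
  | _ m ih =>
    have key : {t : BinaryTree ℕ | t.numNodes = m ∧ ∀ a ∈ inorder t, a < n} ⊆
        {.nil} ∪ ⋃ i ∈ Set.Iio m, ⋃ j ∈ Set.Iio m,
          (fun p : ℕ × BinaryTree ℕ × BinaryTree ℕ => BinaryTree.node p.1 p.2.1 p.2.2) ''
            (Set.Iio n ×ˢ ({t | t.numNodes = i ∧ ∀ a ∈ inorder t, a < n} ×ˢ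
              {t | t.numNodes = j ∧ ∀ a ∈ inorder t, a < n})) := by
      rintro (_ | ⟨a, l, r⟩) ⟨h1, h2⟩
      · exact Or.inl rfl
      · right
        simp only [BinaryTree.numNodes] at h1
        simp only [inorder, List.mem_append, List.mem_cons] at h2
        simp only [Set.mem_iUnion]
        exact ⟨l.numNodes, by simp; omega, r.numNodes, by simp; omega, (a, l, r),
          ⟨h2 a (by simp), ⟨rfl, fun b hb => h2 b (Or.inl hb)⟩,
            ⟨rfl, fun b hb => h2 b (Or.inr (Or.inr hb))⟩⟩, rfl⟩
    refine Set.Finite.subset ((Set.finite_singleton _).union ?_) key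
    refine (Set.finite_Iio m).biUnion fun i hi => (Set.finite_Iio m).biUnion fun j hj => ?_
    exact Set.Finite.image _ ((Set.finite_Iio n).prod ((ih i hi).prod (ih j hj)))

/-- The binary trees with `m` vertices labelled by elements of `{0, …, n - 1}`, in which the label
of a child plus `e` is at most the label of its parent. -/
noncomputable def coloredTrees (e m n : ℕ) : Finset (BinaryTree ℕ) :=
  ((finite_setOf_numNodes_eq_of_forall_lt m n).subset (t := {t | (t.numNodes = m ∧
    ∀ a ∈ inorder t, a < n) ∧ ChildRel (fun u v => u + e ≤ v) t}) fun _ h => h.1).toFinset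

theorem mem_coloredTrees {e m n : ℕ} {t : BinaryTree ℕ} :
    t ∈ coloredTrees e m n ↔ (t.numNodes = m ∧ ∀ a ∈ inorder t, a < n) ∧
      ChildRel (fun u v => u + e ≤ v) t := by
  simp [coloredTrees]

theorem card_coloredTrees_zero (e n : ℕ) : (coloredTrees e 0 n).card = 1 := by
  rw [Finset.card_eq_one]
  refine ⟨.nil, Finset.ext fun t => ?_⟩
  rw [mem_coloredTrees, Finset.mem_singleton]
  cases t with
  | nil => simp [inorder, childRel_nil]
  | node => simp

theorem card_coloredTrees_succ_zero (e m : ℕ) : (coloredTrees e (m + 1) 0).card = 0 := by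
  rw [Finset.card_eq_zero, Finset.eq_empty_iff_forall_notMem]
  intro t ht
  rw [mem_coloredTrees] at ht
  cases t with
  | nil => simp at ht
  | node a l r => exact absurd (ht.1.2 a (by simp [inorder])) (by simp)

/-- If the root does not have the top label `n`, no vertex has it. If it does, the subtrees are
arbitrary with labels below `n + 1 - e`, that is below `n` in the strict case and below `n + 1` in
the weak one. -/
theorem coloredTrees_succ_succ {e : ℕ} (he : e ≤ 1) (m n : ℕ) :
    coloredTrees e (m + 1) (n + 1) = coloredTrees e (m + 1) n ∪
      (Finset.HasAntidiagonal.antidiagonal m).biUnion fun p => Finset.image₂ (BinaryTree.node n)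
        (coloredTrees e p.1 (n + 1 - e)) (coloredTrees e p.2 (n + 1 - e)) := by
  have htrans : ∀ x y z : ℕ, x + e ≤ y → y + e ≤ z → x + e ≤ z := by intros; omega
  ext t
  simp only [Finset.mem_union, Finset.mem_biUnion, Finset.HasAntidiagonal.mem_antidiagonal,
    Finset.mem_image₂, mem_coloredTrees]
  cases t with
  | nil => simp
  | node a l r =>
    simp only [childRel_node_iff_of_trans htrans, inorder, List.mem_append, List.mem_cons,
      BinaryTree.numNodes, BinaryTree.node.injEq]
    constructor
    · rintro ⟨⟨h1, h2⟩, h3, h4, h5, h6⟩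
      have ha := h2 a (by simp)
      by_cases han : a = n
      · right
        subst han
        refine ⟨(l.numNodes, r.numNodes), by simp at h1 ⊢; omega, l,
          ⟨⟨rfl, fun b hb => ?_⟩, h5⟩, r, ⟨⟨rfl, fun b hb => ?_⟩, h6⟩, rfl, rfl, rfl⟩
        · have := h3 b hb; omega
        · have := h4 b hb; omega
      · left
        refine ⟨⟨h1, ?_⟩, h3, h4, h5, h6⟩
        rintro b (hb | rfl | hb)
        · have := h3 b hb; omega
        · omega
        · have := h4 b hb; omega
    · rintro (⟨⟨h1, h2⟩, h3⟩ | ⟨p, hp, l', ⟨⟨h1, h2⟩, h3⟩, r', ⟨⟨h4, h5⟩, h6⟩, rfl, rfl, rfl⟩)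
      · exact ⟨⟨h1, fun b hb => (h2 b hb).trans (Nat.lt_succ_self n)⟩, h3⟩
      · refine ⟨⟨by omega, ?_⟩, fun b hb => ?_, fun b hb => ?_, h3, h6⟩
        · rintro b (hb | rfl | hb)
          · have := h2 b hb; omega
          · omega
          · have := h5 b hb; omega
        · have := h2 b hb; omega
        · have := h5 b hb; omega

theorem card_coloredTrees_succ_succ {e : ℕ} (he : e ≤ 1) (m n : ℕ) :
    (coloredTrees e (m + 1) (n + 1)).card = (coloredTrees e (m + 1) n).card +
      ∑ p ∈ Finset.HasAntidiagonal.antidiagonal m,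
        (coloredTrees e p.1 (n + 1 - e)).card * (coloredTrees e p.2 (n + 1 - e)).card := by
  rw [coloredTrees_succ_succ he, Finset.card_union_of_disjoint, Finset.card_biUnion]
  · congr 1
    refine Finset.sum_congr rfl fun p _ => Finset.card_image₂ ?_ _ _
    intro l l' r r' h
    simpa using h
  · intro p _ q _ hpq
    rw [Function.onFun, Finset.disjoint_left]
    intro t ht ht'
    simp only [Finset.mem_image₂, mem_coloredTrees] at ht ht'
    obtain ⟨l, hl, r, hr, rfl⟩ := ht
    obtain ⟨l', hl', r', hr', h⟩ := ht'
    simp only [BinaryTree.node.injEq, true_and] at h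
    obtain ⟨rfl, rfl⟩ := h
    -- The pair of subtree sizes can be read off the tree.
    exact hpq (Prod.ext (hl.1.1.symm.trans hl'.1.1) (hr.1.1.symm.trans hr'.1.1))
  · rw [Finset.disjoint_left]
    intro t ht ht'
    simp only [Finset.mem_biUnion, Finset.mem_image₂] at ht'
    obtain ⟨p, -, l, -, r, -, rfl⟩ := ht'
    rw [mem_coloredTrees] at ht
    exact lt_irrefl n (ht.1.2 n (by simp [inorder]))

/-- With one color, weak compatibility is no constraint; in the recursion the term with no colors
vanishes and Catalan's convolution remains. -/
theorem card_coloredTrees_zero_one (m : ℕ) : (coloredTrees 0 m 1).card = catalan m := by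
  induction m using Nat.strong_induction_on with
  | _ m ih =>
    cases m with
    | zero => rw [card_coloredTrees_zero, catalan_zero]
    | succ m =>
      rw [card_coloredTrees_succ_succ zero_le_one, card_coloredTrees_succ_zero, catalan_succ',
        zero_add]
      refine Finset.sum_congr rfl fun p hp => ?_
      have := Finset.HasAntidiagonal.mem_antidiagonal.1 hp
      rw [zero_add, Nat.sub_zero, ih p.1 (by omega), ih p.2 (by omega)]

/-! ### Polynomiality and reciprocity -/

open Polynomial in
theorem exists_polynomial_comp_X_add_one {𝕜 : Type*} [Field 𝕜] [CharZero 𝕜] (p : 𝕜[X]) :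
    ∃ q : 𝕜[X], q.comp (X + 1) = q + p := by
  induction p using Polynomial.induction_on' with
  | add p p' hp hp' =>
    obtain ⟨q, hq⟩ := hp
    obtain ⟨q', hq'⟩ := hp'
    exact ⟨q + q', by rw [add_comp, hq, hq']; ring⟩
  | monomial k a =>
    let _ : Algebra ℚ 𝕜 := DivisionRing.toRatAlgebra
    have h := congrArg (Polynomial.map (algebraMap ℚ 𝕜))
      (Polynomial.bernoulli_comp_one_add_X (k + 1))
    -- The Bernoulli polynomials satisfy B_{k+1}(X + 1) - B_{k+1}(X) = (k + 1) X^k.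
    refine ⟨C (a / (k + 1 : 𝕜)) * (Polynomial.bernoulli (k + 1)).map (algebraMap ℚ 𝕜), ?_⟩
    have hk : (k + 1 : 𝕜) ≠ 0 := by exact_mod_cast k.succ_ne_zero
    simp only [Polynomial.map_comp, Polynomial.map_add, Polynomial.map_one, Polynomial.map_X,
      nsmul_eq_mul, Polynomial.map_mul, Polynomial.map_natCast, Polynomial.map_pow,
      Nat.add_sub_cancel] at h
    rw [mul_comp, C_comp, add_comm X 1, h, mul_add, ← mul_assoc, ← Polynomial.C_eq_natCast,
      ← C_mul, ← C_mul_X_pow_eq_monomial]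
    congr 3
    push_cast
    field_simp

theorem exists_polynomial_of_sub {𝕜 : Type*} [Field 𝕜] [CharZero 𝕜] (p : Polynomial 𝕜) (f : ℕ → 𝕜)
    (hf : ∀ n, f (n + 1) = f n + p.eval (n : 𝕜)) :
    ∃ q : Polynomial 𝕜, ∀ n : ℕ, q.eval (n : 𝕜) = f n := by
  obtain ⟨q, hq⟩ := exists_polynomial_comp_X_add_one p
  refine ⟨q + Polynomial.C (f 0 - q.eval 0), fun n => ?_⟩
  induction n with
  | zero => simp
  | succ n ih =>
    have h := congrArg (Polynomial.eval (n : 𝕜)) hq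
    simp only [Polynomial.eval_comp, Polynomial.eval_add, Polynomial.eval_X, Polynomial.eval_one,
      Polynomial.eval_C] at h ih ⊢
    rw [hf, ← ih]
    push_cast
    rw [h]
    ring

/-- For `e = 1` the difference in `n` involves only smaller trees, at the same `n`, so by induction
it is a polynomial, and a polynomial difference can be summed to a polynomial. -/
theorem exists_polynomial_card_coloredTrees (𝕜 : Type*) [Field 𝕜] [CharZero 𝕜] (m : ℕ) :
    ∃ q : Polynomial 𝕜, ∀ n : ℕ, q.eval (n : 𝕜) = ((coloredTrees 1 m n).card : 𝕜) := by
  induction m using Nat.strong_induction_on with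
  | _ m ih =>
    cases m with
    | zero => exact ⟨1, fun n => by simp [card_coloredTrees_zero]⟩
    | succ m =>
      choose! P hP using ih
      refine exists_polynomial_of_sub
        (∑ p ∈ Finset.HasAntidiagonal.antidiagonal m, P p.1 * P p.2) _ fun n => ?_
      rw [card_coloredTrees_succ_succ le_rfl]
      push_cast
      rw [Polynomial.eval_finsetSum]
      congr 1
      refine Finset.sum_congr rfl fun p hp => ?_
      have := Finset.HasAntidiagonal.mem_antidiagonal.1 hp
      rw [Polynomial.eval_mul, hP _ (by omega), hP _ (by omega)]

theorem polynomial_eq_of_eval_natCast_eq {𝕜 : Type*} [Field 𝕜] [CharZero 𝕜] {p q : Polynomial 𝕜}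
    (h : ∀ n : ℕ, p.eval (n : 𝕜) = q.eval (n : 𝕜)) : p = q := by
  refine Polynomial.eq_of_infinite_eval_eq p q ((Set.infinite_range_of_injective
    (Nat.cast_injective (R := 𝕜))).mono ?_)
  rintro _ ⟨n, rfl⟩
  exact h n

theorem eval_neg_natCast_of_card_coloredTrees {𝕜 : Type*} [Field 𝕜] [CharZero 𝕜]
    {P : ℕ → Polynomial 𝕜} (hP : ∀ m n : ℕ, (P m).eval (n : 𝕜) = ((coloredTrees 1 m n).card : 𝕜))
    (m n : ℕ) : (-1) ^ m * (P m).eval (-(n : 𝕜)) = ((coloredTrees 0 m n).card : 𝕜) := by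
  induction m using Nat.strong_induction_on generalizing n with
  | _ m ih =>
    cases m with
    | zero =>
      have : P 0 = 1 := polynomial_eq_of_eval_natCast_eq fun n => by
        rw [hP, card_coloredTrees_zero]; simp
      simp [this, card_coloredTrees_zero]
    | succ m =>
      induction n with
      | zero =>
        have := hP (m + 1) 0
        rw [card_coloredTrees_succ_zero] at this
        simpa [card_coloredTrees_succ_zero] using this
      | succ n ihn =>
        -- The strict recursion holds at all natural numbers, hence as an identity of polynomials,
        -- and may be evaluated at negative integers.
        have hrec : (P (m + 1)).comp (Polynomial.X + 1) =
            P (m + 1) + ∑ p ∈ Finset.HasAntidiagonal.antidiagonal m, P p.1 * P p.2 := by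
          refine polynomial_eq_of_eval_natCast_eq fun n => ?_
          simp only [Polynomial.eval_comp, Polynomial.eval_add, Polynomial.eval_X,
            Polynomial.eval_one, Polynomial.eval_finsetSum, Polynomial.eval_mul, hP]
          rw [← Nat.cast_succ, hP, Nat.succ_eq_add_one, card_coloredTrees_succ_succ le_rfl]
          simp
        have h := congrArg (Polynomial.eval (-((n + 1 : ℕ) : 𝕜))) hrec
        simp only [Polynomial.eval_comp, Polynomial.eval_add, Polynomial.eval_X,
          Polynomial.eval_one, Polynomial.eval_finsetSum, Polynomial.eval_mul] at h
        rw [show -((n + 1 : ℕ) : 𝕜) + 1 = -(n : 𝕜) by push_cast; ring] at h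
        rw [card_coloredTrees_succ_succ zero_le_one,
          Nat.cast_add (coloredTrees 0 (m + 1) n).card, ← ihn, h, mul_add, Nat.cast_sum,
          add_assoc, left_eq_add, Finset.mul_sum, ← Finset.sum_add_distrib]
        refine Finset.sum_eq_zero fun p hp => ?_
        have hpm := Finset.HasAntidiagonal.mem_antidiagonal.1 hp
        -- The terms cancel in pairs since (-1)^{i+j+1} = -(-1)^i (-1)^j.
        rw [Nat.cast_mul, Nat.sub_zero, ← ih p.1 (by omega), ← ih p.2 (by omega), ← hpm]
        ring

/-! ### Evaluation of the basic invariant on sets of paths -/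

theorem zetaTensor_consTensor (𝕜 : Type*) [Field 𝕜] {V : Type*} [DecidableEq V] {n : ℕ}
    (S : Fin (n + 1) → Finset V) (x : F 𝕜 (S 0)) (y : ⨂[𝕜] i : Fin n, F 𝕜 (S i.succ)) :
    zetaTensor 𝕜 S (consTensor 𝕜 (fun i => F 𝕜 (S i)) (x ⊗ₜ y)) =
      zeta 𝕜 (S 0) x * zetaTensor 𝕜 (fun i => S i.succ) y := by
  induction y using PiTensorProduct.induction_on with
  | smul_tprod r f =>
    simp [zetaTensor, consTensor, Fin.prod_univ_succ, mul_left_comm]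
  | add a b ha hb =>
    rw [TensorProduct.tmul_add, map_add, map_add, map_add, ha, hb, mul_add]

theorem zetaTensor_isEmptyEquiv_symm (𝕜 : Type*) [Field 𝕜] {V : Type*} [DecidableEq V]
    (S : Fin 0 → Finset V) (x : 𝕜) :
    zetaTensor 𝕜 S ((PiTensorProduct.isEmptyEquiv (Fin 0)).symm x) = x := by
  simp [zetaTensor]

/-- The word `s` is the in-order reading of a binary tree on which `d` strictly increases from each
vertex to its children. -/
def HasIncreasingTree {V : Type*} (d : V → ℕ) (s : List V) : Prop :=
  ∃ t : BinaryTree V, inorder t = s ∧ ChildRel (fun u v => d v < d u) t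

theorem hasIncreasingTree_nil {V : Type*} (d : V → ℕ) : HasIncreasingTree d [] :=
  ⟨.nil, rfl, childRel_nil _⟩

theorem childRel_node_lt {V : Type*} {d : V → ℕ} {a : V} {l r : BinaryTree V} :
    ChildRel (fun u v => d v < d u) (.node a l r) ↔ (∀ u ∈ inorder l, d a < d u) ∧
      (∀ u ∈ inorder r, d a < d u) ∧ ChildRel (fun u v => d v < d u) l ∧
        ChildRel (fun u v => d v < d u) r :=
  childRel_node_iff_of_trans fun _ _ _ h h' => h'.trans h

/-- The mirror image of the tree works. This makes the property one of paths rather than of words.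
-/
theorem HasIncreasingTree.reverse {V : Type*} {d : V → ℕ} {s : List V}
    (h : HasIncreasingTree d s) : HasIncreasingTree d s.reverse := by
  obtain ⟨t, rfl, ht⟩ := h
  induction t with
  | nil => exact hasIncreasingTree_nil d
  | node a l r hl hr =>
    obtain ⟨h1, h2, h3, h4⟩ := childRel_node_lt.1 ht
    obtain ⟨l', hl1, hl2⟩ := hl h3
    obtain ⟨r', hr1, hr2⟩ := hr h4
    refine ⟨.node a r' l', by simp [inorder, hl1, hr1], childRel_node_lt.2 ⟨?_, ?_, hr2, hl2⟩⟩
    · simpa [hr1] using h2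
    · simpa [hl1] using h1

/-- One step of the iterated coproduct. The letters in `S` are those where `d` takes the least
allowed value `k`, and only the root of an increasing tree can do so. If there is one, the pieces
are the words of the two subtrees; if there is none, the only piece is the whole word. -/
theorem hasIncreasingTree_iff_pieces {V : Type*} [DecidableEq V] {d : V → ℕ} {k : ℕ} {S : Finset V}
    {s : List V} (hk : ∀ v ∈ s, k ≤ d v) (hS : ∀ v ∈ s, v ∈ S ↔ d v = k) :
    HasIncreasingTree d s ↔ (s.filter (fun v => decide (v ∈ S))).length ≤ 1 ∧
      ∀ p ∈ s.splitOnP (fun v => decide (v ∈ S)), HasIncreasingTree d p := by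
  by_cases hs : ∀ v ∈ s, v ∉ S
  · have hs' : ∀ v ∈ s, decide (v ∈ S) = false := by simpa using hs
    rw [List.splitOnP_eq_singleton hs', List.filter_eq_nil_iff.2 (by simpa using hs)]
    simp
  constructor
  · rintro ⟨t, rfl, ht⟩
    cases t with
    | nil => simp [inorder] at hs
    | node b l r =>
      obtain ⟨h1, h2, h3, h4⟩ := childRel_node_lt.1 ht
      have hb := hk b (by simp [inorder])
      have hl : ∀ v ∈ inorder l, v ∉ S := fun v hv hvS => by
        have := (hS v (by simp [inorder, hv])).1 hvS
        have := h1 v hv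
        omega
      have hr : ∀ v ∈ inorder r, v ∉ S := fun v hv hvS => by
        have := (hS v (by simp [inorder, hv])).1 hvS
        have := h2 v hv
        omega
      have hbS : b ∈ S := by
        push Not at hs
        obtain ⟨v, hv, hvS⟩ := hs
        simp only [inorder, List.mem_append, List.mem_cons] at hv
        rcases hv with hv | rfl | hv
        exacts [(hl v hv hvS).elim, hvS, (hr v hv hvS).elim]
      rw [inorder, List.splitOnP_append_cons _ _ (by simpa using hbS),
        List.splitOnP_eq_singleton (by simpa using hl),
        List.splitOnP_eq_singleton (by simpa using hr), List.filter_append, List.filter_cons,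
        List.filter_eq_nil_iff.2 (by simpa using hl), List.filter_eq_nil_iff.2 (by simpa using hr)]
      simp only [hbS]
      refine ⟨by simp, ?_⟩
      simp only [List.cons_append, List.nil_append, List.mem_cons, List.not_mem_nil, or_false,
        forall_eq_or_imp, forall_eq]
      exact ⟨⟨l, rfl, h3⟩, ⟨r, rfl, h4⟩⟩
  · rintro ⟨h1, h2⟩
    push Not at hs
    obtain ⟨a, ha, haS⟩ := hs
    obtain ⟨x, y, rfl⟩ := List.append_of_mem ha
    have hxy : ∀ v, v ∈ x ∨ v ∈ y → v ∉ S := by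
      simp only [List.filter_append, List.filter_cons, haS, decide_true, if_true,
        List.length_append, List.length_cons] at h1
      have hx : x.filter (fun v => decide (v ∈ S)) = [] := List.length_eq_zero_iff.1 (by omega)
      have hy : y.filter (fun v => decide (v ∈ S)) = [] := List.length_eq_zero_iff.1 (by omega)
      rintro v (hv | hv)
      · simpa using List.filter_eq_nil_iff.1 hx v hv
      · simpa using List.filter_eq_nil_iff.1 hy v hv
    rw [List.splitOnP_append_cons _ _ (by simpa using haS),
      List.splitOnP_eq_singleton (by simpa using fun v hv => hxy v (Or.inl hv)),
      List.splitOnP_eq_singleton (by simpa using fun v hv => hxy v (Or.inr hv))] at h2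
    obtain ⟨l, hl, hl'⟩ := h2 x (by simp)
    obtain ⟨r, hr, hr'⟩ := h2 y (by simp)
    have hlt : ∀ v, v ∈ x ∨ v ∈ y → d a < d v := fun v hv => by
      have hm : v ∈ x ++ a :: y := by
        simp only [List.mem_append, List.mem_cons]; tauto
      have e1 := (hS a ha).1 haS
      have e2 := hk v hm
      have e3 := mt (hS v hm).2 (hxy v hv)
      omega
    exact ⟨.node a l r, by rw [inorder, hl, hr], childRel_node_lt.2
      ⟨fun u hu => hlt u (Or.inl (hl ▸ hu)), fun u hu => hlt u (Or.inr (hr ▸ hu)), hl', hr'⟩⟩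

theorem UWord.mk_eq_mk_singleton {V : Type*} {s : List V} {v : V} :
    UWord.mk s = UWord.mk [v] ↔ s = [v] := by
  rw [UWord.mk_eq_mk]
  constructor
  · rintro (h | h)
    · exact h.symm
    · simpa using (congrArg List.reverse h).symm
  · rintro rfl
    exact Or.inl rfl

theorem UWord.support_mk_nonempty {V : Type*} [DecidableEq V] {s : List V} :
    (UWord.mk s).support.Nonempty ↔ s ≠ [] := by
  rw [UWord.support_mk, List.toFinset_nonempty_iff]

namespace SetOfPaths

theorem isDiscrete_restrict_iff {V : Type*} [DecidableEq V] {I : Finset V} (α : SetOfPaths I)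
    (S : Finset V) (hS : S ⊆ I) : (α.restrict S hS).IsDiscrete ↔
      ∀ s, UWord.mk s ∈ α.paths → (s.filter (fun v => decide (v ∈ S))).length ≤ 1 := by
  constructor
  · intro h s hs
    by_cases he : s.filter (fun v => decide (v ∈ S)) = []
    · simp [he]
    · obtain ⟨v, hv⟩ := h _ ⟨UWord.support_mk_nonempty.2 he, UWord.mk s, hs, rfl⟩
      rw [UWord.mk_eq_mk_singleton.1 hv]
      simp
  · rintro h q ⟨hq, p, hp, rfl⟩
    obtain ⟨s, rfl⟩ := p.exists_rep
    rw [UWord.restrict_mk, UWord.support_mk_nonempty] at hq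
    have h1 := h s hp
    have h2 := List.length_pos_iff.2 hq
    obtain ⟨v, hv⟩ := List.length_eq_one_iff.1 (le_antisymm h1 h2)
    exact ⟨v, by rw [UWord.restrict_mk, hv]⟩

/-- Contraction forgets empty pieces while `splitOnP` lists them, whence `hQ`. Both sides range over
all representing words, so `Q` need not be invariant under reversal. -/
theorem forall_mem_contract_paths_iff {V : Type*} [DecidableEq V] {I : Finset V} (α : SetOfPaths I)
    (S T : Finset V) (hST : S ∪ T = I) (hd : Disjoint S T) {Q : List V → Prop} (hQ : Q []) :
    (∀ s, UWord.mk s ∈ (α.contract S T hST hd).paths → Q s) ↔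
      ∀ s, UWord.mk s ∈ α.paths → ∀ p ∈ s.splitOnP (fun v => decide (v ∈ S)), Q p := by
  constructor
  · intro h s hs p hp
    by_cases he : p = []
    · rwa [he]
    · exact h p ⟨UWord.support_mk_nonempty.2 he, UWord.mk s, hs, s, p, rfl, hp, rfl⟩
  · rintro h s ⟨-, p, hp, w, s', rfl, hs', e⟩
    rcases UWord.mk_eq_mk.1 e with rfl | rfl
    · exact h w hp _ hs'
    · refine h w.reverse ?_ _ ?_
      · rwa [UWord.mk_eq_mk.2 (Or.inr (List.reverse_reverse w).symm)]
      · rw [splitOnP_reverse]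
        simpa using hs'

theorem mem_of_mem_of_mk_mem {V : Type*} [DecidableEq V] {I : Finset V} (α : SetOfPaths I)
    {s : List V} (hs : UWord.mk s ∈ α.paths) {v : V} (hv : v ∈ s) : v ∈ I :=
  (α.cover v).2 ⟨_, hs, by simpa using hv⟩

end SetOfPaths

open Classical in
theorem zetaTensor_iteratedCoproduct_single (𝕜 : Type*) [Field 𝕜] {V : Type*} [DecidableEq V]
    {n : ℕ} (S : Fin n → Finset V) {I : Finset V} (h : IsDecomposition S I) (α : SetOfPaths I)
    (d : V → ℕ) (k : ℕ) (hd : ∀ i, ∀ v ∈ S i, d v = k + i) :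
    zetaTensor 𝕜 S (iteratedCoproduct 𝕜 S h (Finsupp.single α 1)) =
      if ∀ s, UWord.mk s ∈ α.paths → HasIncreasingTree d s then 1 else 0 := by
  induction n generalizing I k with
  | zero =>
    have hI : ∀ v, v ∉ I := fun v hv => by
      rw [← h.2] at hv
      simp at hv
    rw [if_pos]
    · simp only [iteratedCoproduct, LinearMap.comp_apply, LinearEquiv.coe_coe,
        zetaTensor_isEmptyEquiv_symm]
      simp [counit]
    · intro s hs
      cases s with
      | nil => exact hasIncreasingTree_nil d
      | cons v s => exact (hI v (α.mem_of_mem_of_mk_mem hs (by simp))).elim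
  | succ n ih =>
    simp only [iteratedCoproduct, LinearMap.comp_apply]
    rw [coproduct, Finsupp.linearCombination_single, one_smul, TensorProduct.map_tmul,
      LinearMap.id_apply, zetaTensor_consTensor,
      -- Dropping the first block shifts the indices by one; the offset `k` lets the same `d` serve
      -- at every stage.
      ih (fun i => S i.succ) h.tail _ (k + 1) (fun i v hv => by
        rw [hd _ v hv, Fin.val_succ]; omega),
      zeta, Finsupp.linearCombination_single, one_smul, ite_zero_mul_ite_zero, mul_one]
    refine if_congr ?_ rfl rfl
    rw [SetOfPaths.isDiscrete_restrict_iff,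
      SetOfPaths.forall_mem_contract_paths_iff _ _ _ _ _ (hasIncreasingTree_nil d), ← forall_and]
    refine forall_congr' fun s => ?_
    rw [← imp_and]
    refine imp_congr_right fun hs => (hasIncreasingTree_iff_pieces (k := k) ?_ ?_).symm
    · intro v hv
      have := α.mem_of_mem_of_mk_mem hs hv
      rw [← h.2, Finset.mem_biUnion] at this
      obtain ⟨i, -, hi⟩ := this
      have := hd i v hi
      omega
    · intro v hv
      have := α.mem_of_mem_of_mk_mem hs hv
      rw [← h.2, Finset.mem_biUnion] at this
      obtain ⟨i, -, hi⟩ := this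
      refine ⟨fun h0 => by simpa using hd 0 v h0, fun h0 => ?_⟩
      have := hd i v hi
      have hi0 : i = 0 := Fin.ext (by rw [Fin.val_zero]; omega)
      exact hi0 ▸ hi

theorem SetOfPaths.IsPathWithWord.forall_mk_mem_paths_iff {V : Type*} [DecidableEq V] {I : Finset V}
    {α : SetOfPaths I} {w : List V} (hα : α.IsPathWithWord w) (d : V → ℕ) :
    (∀ s, UWord.mk s ∈ α.paths → HasIncreasingTree d s) ↔ HasIncreasingTree d w := by
  obtain ⟨hw, hI, rfl⟩ := hα
  constructor
  · intro h
    -- On the empty set `ofWord` has no paths at all, so the empty word is treated apart.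
    by_cases he : w = []
    · rw [he]
      exact hasIncreasingTree_nil d
    · exact h w ⟨UWord.support_mk_nonempty.2 he, rfl⟩
  · rintro h s ⟨-, hs⟩
    rcases UWord.mk_eq_mk.1 hs with rfl | rfl
    · exact h
    · simpa using h.reverse

/-! ### Colorings and decompositions -/

/-- The extension of a coloring of `I` by zero, with values in `ℕ`. -/
def extendColoring {V : Type*} [DecidableEq V] {I : Finset V} {n : ℕ} (c : I → Fin n) (v : V) : ℕ :=
  if h : v ∈ I then c ⟨v, h⟩ else 0

theorem extendColoring_coe {V : Type*} [DecidableEq V] {I : Finset V} {n : ℕ} (c : I → Fin n)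
    (v : I) : extendColoring c v = c v := by
  simp [extendColoring]

theorem extendColoring_lt {V : Type*} [DecidableEq V] {I : Finset V} {n : ℕ} (c : I → Fin n) {v : V}
    (hv : v ∈ I) : extendColoring c v < n := by
  simp [extendColoring, hv]

theorem ChildRel.congr {V : Type*} {R R' : V → V → Prop} {t : BinaryTree V}
    (h : ∀ u ∈ inorder t, ∀ v ∈ inorder t, R u v ↔ R' u v) : ChildRel R t ↔ ChildRel R' t :=
  forall_congr' fun u => forall_congr' fun v => imp_congr_right fun huv =>
    h u (isChild_mem huv).1 v (isChild_mem huv).2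

theorem childRel_extendColoring_iff {V : Type*} [DecidableEq V] {I : Finset V} {n : ℕ}
    {c : I → Fin n} {t : BinaryTree V} (ht : (inorder t).toFinset = I) (e : ℕ) :
    ChildRel (fun u v => extendColoring c u + e ≤ extendColoring c v) t ↔
      ∀ u v : I, IsChild t (u : V) (v : V) → (c u : ℕ) + e ≤ c v := by
  constructor
  · intro h u v huv
    simpa only [extendColoring_coe] using h u v huv
  · intro h u v huv
    have hm := isChild_mem huv
    rw [← List.mem_toFinset, ht, ← List.mem_toFinset, ht] at hm
    simpa only [← extendColoring_coe] using h ⟨u, hm.1⟩ ⟨v, hm.2⟩ huv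

/-- Label the tree along `w`, then replace each letter by its color. Conversely, a tree of colors
yields its shape and, read in order along `w`, the coloring. -/
theorem card_pairs_eq_card_coloredTrees {V : Type*} [DecidableEq V] {I : Finset V} {w : List V}
    (hw : w.Nodup) (hI : w.toFinset = I) (e n : ℕ) :
    Nat.card {p : BinaryTree Unit × (I → Fin n) // p.1.numNodes = I.card ∧
      ∃ t', IsLabelling w p.1 t' ∧
        ∀ u v : I, IsChild t' (u : V) (v : V) → (p.2 u : ℕ) + e ≤ p.2 v} =
      (coloredTrees e I.card n).card := by
  have hcard : w.length = I.card := by rw [← hI, List.toFinset_card_of_nodup hw]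
  have hmem : ∀ v, v ∈ w ↔ v ∈ I := fun v => by rw [← hI, List.mem_toFinset]
  rw [← Nat.card_eq_finsetCard (coloredTrees e I.card n)]
  have hval : ∀ p : {p : BinaryTree Unit × (I → Fin n) // p.1.numNodes = I.card ∧
      ∃ t', IsLabelling w p.1 t' ∧
        ∀ u v : I, IsChild t' (u : V) (v : V) → (p.2 u : ℕ) + e ≤ p.2 v},
      p.2.2.choose.map (extendColoring p.1.2) ∈ coloredTrees e I.card n := by
    rintro ⟨⟨t, c⟩, h1, h2⟩
    obtain ⟨⟨h3, h4⟩, h5⟩ := h2.choose_spec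
    set t' := h2.choose
    refine mem_coloredTrees.2 ⟨⟨?_, ?_⟩, ?_⟩
    · rw [← length_inorder, inorder_map, List.length_map, h4, hcard]
    · rw [inorder_map, h4]
      intro a ha
      obtain ⟨v, hv, rfl⟩ := List.mem_map.1 ha
      exact extendColoring_lt c ((hmem v).1 hv)
    · rw [childRel_map, childRel_extendColoring_iff (by rw [h4, hI])]
      exact h5
  refine Nat.card_eq_of_bijective (fun p => ⟨_, hval p⟩) ⟨?_, ?_⟩
  · rintro ⟨⟨t, c⟩, h1, h2⟩ ⟨⟨t₁, c₁⟩, h1', h2'⟩ heq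
    simp only [Subtype.mk.injEq] at heq
    obtain ⟨h3, -⟩ := h2.choose_spec
    obtain ⟨h3', -⟩ := h2'.choose_spec
    set s := h2.choose
    set s₁ := h2'.choose
    have ht : t = t₁ := by
      have := congrArg (BinaryTree.map fun _ => ()) heq
      rw [← BinaryTree.comp_map, ← BinaryTree.comp_map] at this
      exact h3.1.symm.trans (this.trans h3'.1)
    have hc : c = c₁ := by
      have := congrArg inorder heq
      rw [inorder_map, inorder_map, h3.2, h3'.2, List.map_inj_left] at this
      funext v
      have := this v ((hmem v).2 v.2)
      rw [extendColoring_coe, extendColoring_coe] at this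
      exact Fin.ext this
    subst ht hc
    rfl
  · rintro ⟨T, hT⟩
    obtain ⟨⟨h1, h2⟩, h3⟩ := mem_coloredTrees.1 hT
    have hlen : (inorder T).length = w.length := by rw [length_inorder, h1, hcard]
    let c : I → Fin n := fun v =>
      ⟨(inorder T)[w.idxOf (v : V)]'(hlen ▸ List.idxOf_lt_length_of_mem ((hmem v).2 v.2)),
        h2 _ (List.getElem_mem _)⟩
    have hc : w.map (extendColoring c) = inorder T := by
      refine List.ext_getElem (by simp [hlen]) fun i hi hi' => ?_
      rw [List.getElem_map]
      have hwi : w[i]'(hlen ▸ hi') ∈ I := (hmem _).1 (List.getElem_mem _)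
      have := extendColoring_coe c ⟨_, hwi⟩
      simp only at this
      rw [this]
      simp only [c, hw.idxOf_getElem]
    obtain ⟨t', ht'⟩ := exists_isLabelling (w := w) (t := T.map fun _ => ())
      (by rw [numNodes_map, h1, hcard])
    -- Stated for every labelling, so that it also covers the one picked by `choose` in `hval`.
    have hTt : ∀ s, IsLabelling w (T.map fun _ => ()) s → s.map (extendColoring c) = T := by
      intro s hs
      refine IsLabelling.unique (w := inorder T) (t := T.map fun _ => ()) ⟨?_, ?_⟩ ⟨rfl, rfl⟩
      · rw [← BinaryTree.comp_map]
        exact hs.1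
      · rw [inorder_map, hs.2, hc]
    have h4 : ∃ t', IsLabelling w (T.map fun _ => ()) t' ∧
        ∀ u v : I, IsChild t' (u : V) (v : V) → (c u : ℕ) + e ≤ c v := by
      refine ⟨t', ht', ?_⟩
      rw [← childRel_extendColoring_iff (by rw [ht'.2, hI]),
        ← childRel_map (R := fun u v => u + e ≤ v), hTt t' ht']
      exact h3
    exact ⟨⟨(T.map fun _ => (), c), by rw [numNodes_map, h1], h4⟩,
      Subtype.ext (hTt _ h4.choose_spec.1)⟩

theorem numCompatible_eq_card_coloredTrees {V : Type*} [DecidableEq V] {I : Finset V} {w : List V}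
    (hw : w.Nodup) (hI : w.toFinset = I) (n : ℕ) :
    numCompatible I w n = (coloredTrees 0 I.card n).card :=
  card_pairs_eq_card_coloredTrees hw hI 0 n

theorem numStrictlyCompatible_eq_card_coloredTrees {V : Type*} [DecidableEq V] {I : Finset V}
    {w : List V} (hw : w.Nodup) (hI : w.toFinset = I) (n : ℕ) :
    numStrictlyCompatible I w n = (coloredTrees 1 I.card n).card :=
  card_pairs_eq_card_coloredTrees hw hI 1 n

/-- The color classes of a coloring, in decreasing order of colors. -/
def colorClasses {V : Type*} [DecidableEq V] {I : Finset V} {n : ℕ} (c : I → Fin n) (i : Fin n) :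
    Finset V :=
  (Finset.univ.filter fun v => c v = i.rev).map (Function.Embedding.subtype _)

theorem mem_colorClasses {V : Type*} [DecidableEq V] {I : Finset V} {n : ℕ} {c : I → Fin n}
    {i : Fin n} {v : V} : v ∈ colorClasses c i ↔ ∃ h : v ∈ I, c ⟨v, h⟩ = i.rev := by
  simp [colorClasses]

theorem colorClasses_mem_decompositions {V : Type*} [DecidableEq V] {I : Finset V} {n : ℕ}
    (c : I → Fin n) : colorClasses c ∈ decompositions I n := by
  rw [mem_decompositions]
  refine ⟨fun i j hij => Finset.disjoint_left.2 fun v hi hj => ?_, ?_⟩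
  · obtain ⟨h, hi⟩ := mem_colorClasses.1 hi
    obtain ⟨h', hj⟩ := mem_colorClasses.1 hj
    exact hij (Fin.rev_injective (hi.symm.trans hj))
  · ext v
    simp only [Finset.mem_biUnion, Finset.mem_univ, true_and, mem_colorClasses]
    exact ⟨fun ⟨i, h, _⟩ => h, fun h => ⟨(c ⟨v, h⟩).rev, h, (Fin.rev_rev _).symm⟩⟩

theorem colorClasses_bijective {V : Type*} [DecidableEq V] (I : Finset V) (n : ℕ) :
    Function.Bijective (fun c : I → Fin n =>
      (⟨colorClasses c, colorClasses_mem_decompositions c⟩ :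
        {S : Fin n → Finset V // S ∈ decompositions I n})) := by
  constructor
  · intro c c' h
    funext v
    have h1 : (v : V) ∈ colorClasses c (c v).rev := mem_colorClasses.2 ⟨v.2, (Fin.rev_rev _).symm⟩
    have h' : colorClasses c = colorClasses c' := congrArg Subtype.val h
    rw [h'] at h1
    obtain ⟨_, h2⟩ := mem_colorClasses.1 h1
    exact (h2.trans (Fin.rev_rev _)).symm
  · rintro ⟨S, hS⟩
    obtain ⟨h1, h2⟩ := mem_decompositions.1 hS
    have h3 : ∀ v : I, ∃ i, (v : V) ∈ S i := fun v => by
      have hv : (v : V) ∈ Finset.univ.biUnion S := by rw [h2]; exact v.2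
      simpa using hv
    choose f hf using h3
    refine ⟨fun v => (f v).rev, Subtype.ext (funext fun i => Finset.ext fun v => ?_)⟩
    simp only [mem_colorClasses]
    constructor
    · rintro ⟨h, hv⟩
      rw [← Fin.rev_injective hv]
      exact hf ⟨v, h⟩
    · intro hv
      have h : v ∈ I := h2 ▸ Finset.mem_biUnion.2 ⟨i, Finset.mem_univ i, hv⟩
      refine ⟨h, congrArg Fin.rev ?_⟩
      by_contra hne
      exact Finset.disjoint_left.1 (h1 _ _ hne) (hf ⟨v, h⟩) hv

/-- A coloring for which some binary tree read along `w` is strictly compatible. -/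
def IsStrictColoring {V : Type*} {I : Finset V} {n : ℕ} (w : List V) (c : I → Fin n) : Prop :=
  ∃ t' : BinaryTree V, inorder t' = w ∧ ∀ u v : I, IsChild t' (u : V) (v : V) → c u < c v

theorem hasIncreasingTree_iff_isStrictColoring {V : Type*} [DecidableEq V] {I : Finset V}
    {w : List V} (hI : w.toFinset = I) {n : ℕ} (c : I → Fin n) :
    HasIncreasingTree (fun v => n - 1 - extendColoring c v) w ↔ IsStrictColoring w c := by
  refine exists_congr fun t => and_congr_right fun ht => ?_
  rw [← ht] at hI
  refine Iff.trans (ChildRel.congr fun u hu v hv => ?_) (childRel_extendColoring_iff hI 1)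
  rw [← List.mem_toFinset, hI] at hu hv
  -- The colors are below `n`, so the truncated subtraction in `n - 1 - _` reverses their order
  -- faithfully.
  have h1 := extendColoring_lt c hu
  have h2 := extendColoring_lt c hv
  beta_reduce
  omega

/-- Forgetting the tree loses nothing, because a strict coloring determines it. -/
theorem numStrictlyCompatible_eq_card_colorings {V : Type*} [DecidableEq V] {I : Finset V}
    {w : List V} (hw : w.Nodup) (hI : w.toFinset = I) (n : ℕ) :
    numStrictlyCompatible I w n = Nat.card {c : I → Fin n // IsStrictColoring w c} := by
  refine Nat.card_eq_of_bijective (fun p => ⟨p.1.2, p.2.2.imp fun t ht => ⟨ht.1.2, ht.2⟩⟩) ⟨?_, ?_⟩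
  · rintro ⟨⟨t, c⟩, h1, t', h2, h3⟩ ⟨⟨t₁, c₁⟩, h1', t₁', h2', h3'⟩ h
    obtain rfl : c = c₁ := congrArg Subtype.val h
    have e : t' = t₁' := by
      refine ChildRel.eq_of_inorder_eq
        (R := fun u v => extendColoring c u + 1 ≤ extendColoring c v) (fun x y z h h' => by omega)
        (fun x => by omega) ?_ ?_ (h2.2.trans h2'.2.symm)
      · exact (childRel_extendColoring_iff (by rw [h2.2, hI]) 1).2 h3
      · exact (childRel_extendColoring_iff (by rw [h2'.2, hI]) 1).2 h3'
    subst e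
    obtain rfl : t = t₁ := h2.1.symm.trans h2'.1
    rfl
  · rintro ⟨c, t', h1, h2⟩
    refine ⟨⟨(t'.map fun _ => (), c), ?_, t', ⟨rfl, h1⟩, h2⟩, rfl⟩
    rw [numNodes_map, ← length_inorder, h1, ← hI, List.toFinset_card_of_nodup hw]

theorem chi_single_eq_numStrictlyCompatible (𝕜 : Type*) [Field 𝕜] {V : Type*} [DecidableEq V]
    {I : Finset V} {α : SetOfPaths I} {w : List V} (hα : α.IsPathWithWord w) (n : ℕ) :
    chi 𝕜 (Finsupp.single α 1) n = (numStrictlyCompatible I w n : 𝕜) := by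
  classical
  obtain ⟨hw, hI, -⟩ := id hα
  rw [numStrictlyCompatible_eq_card_colorings hw hI, chi,
    ← (colorClasses_bijective I n).sum_comp, Nat.card_eq_fintype_card, Fintype.card_subtype,
    ← Finset.sum_boole]
  refine Finset.sum_congr rfl fun c _ => ?_
  -- The block with index `i` is the class of the color `i.rev`, so `n - 1` minus the color recovers
  -- the index.
  rw [zetaTensor_iteratedCoproduct_single 𝕜 _ _ α (fun v => n - 1 - extendColoring c v) 0]
  · exact if_congr ((hα.forall_mk_mem_paths_iff _).trans
      (hasIncreasingTree_iff_isStrictColoring hI c)) rfl rfl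
  · intro i v hv
    obtain ⟨h, hc⟩ := mem_colorClasses.1 hv
    have := extendColoring_coe c ⟨v, h⟩
    simp only [hc, Fin.val_rev] at this
    omega

end PathMonoid

theorem mainTheorem5 (𝕜 : Type*) [Field 𝕜] {V : Type*} [DecidableEq V] (I : Finset V)
    (α : PathMonoid.SetOfPaths I) (w : List V) (hα : α.IsPathWithWord w) :
    (∀ n : ℕ, PathMonoid.chi 𝕜 (Finsupp.single α 1) n =
      (PathMonoid.numStrictlyCompatible I w n : 𝕜)) ∧
    (CharZero 𝕜 →
      (∃! P : Polynomial 𝕜, PathMonoid.IsBasicInvariantPolynomial (Finsupp.single α 1) P) ∧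
      ∀ P : Polynomial 𝕜, PathMonoid.IsBasicInvariantPolynomial (Finsupp.single α 1) P →
        (∀ n : ℕ, (-1) ^ I.card * P.eval (-(n : 𝕜)) = (PathMonoid.numCompatible I w n : 𝕜)) ∧
        (-1) ^ I.card * P.eval (-1) = (catalan I.card : 𝕜)) := by
  have hchi := PathMonoid.chi_single_eq_numStrictlyCompatible 𝕜 hα
  obtain ⟨hw, hI, -⟩ := id hα
  refine ⟨hchi, fun _ => ?_⟩
  choose P hP using PathMonoid.exists_polynomial_card_coloredTrees 𝕜
  have hPα : PathMonoid.IsBasicInvariantPolynomial (Finsupp.single α 1) (P I.card) := fun n => by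
    rw [hP, hchi, PathMonoid.numStrictlyCompatible_eq_card_coloredTrees hw hI]
  have huniq : ∀ Q : Polynomial 𝕜,
      PathMonoid.IsBasicInvariantPolynomial (Finsupp.single α 1) Q → Q = P I.card := fun Q hQ =>
    PathMonoid.polynomial_eq_of_eval_natCast_eq fun n => (hQ n).trans (hPα n).symm
  refine ⟨⟨P I.card, hPα, huniq⟩, fun Q hQ => ?_⟩
  have hneg := PathMonoid.eval_neg_natCast_of_card_coloredTrees hP I.card
  rw [huniq Q hQ]
  refine ⟨fun n => ?_, ?_⟩
  · rw [hneg, PathMonoid.numCompatible_eq_card_coloredTrees hw hI]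
  · rw [← PathMonoid.card_coloredTrees_zero_one, ← hneg, Nat.cast_one]
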